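/- Let $k$ be a field and let $H$ be a finite-dimensional Hopf algebra over $k$ with counit $\varepsilon$ and comultiplication $\Delta(h)=\sum h_1\otimes h_2$. Let $\Lambda\in H$ be a nonzero left integral, i.e. $\Lambda\neq 0$ and $h\Lambda=\varepsilon(h)\Lambda$ for all $h\in H$. Let $R$ be a left $H$-module algebra, i.e. a (not necessarily commutative) $k$-algebra with a left $H$-module structure that is compatible with the $k$-structure and satisfies $h\cdot 1=\varepsilon(h)1$ and $h\cdot(ab)=\sum(h_1\cdot a)(h_2\cdot b)$ for all $h\in H$ and $a,b\in R$. Let $R^H=\{r\in R : h\cdot r=\varepsilon(h)r \text{ for all } h\in H\}$ be the subalgebra of $H$-invariants; it contains $\Lambda R=\{\Lambda\cdot r : r\in R\}$ as a $k$-subspace. Let $T=R\# H$ be the smash product, i.e. the $k$-algebra $R\otimes_k H$ with multiplication $(r\# h)(r'\# h')=\sum r(h_1\cdot r')\# h_2h'$; it contains $H$ as the subalgebra $1\# H$, and $T$-modules are regarded as $H$-modules by restriction. The stable module category $\mathrm{StMod}(H)$ has the left $H$-modules as its objects, and its morphisms are the classes of $H$-module homomorphisms, where $\alpha,\beta\colon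 M\to N$ are identified if $\alpha-\beta$ factors through a projective $H$-module. An $H$-module is called stably finitely generated if it is isomorphic in $\mathrm{StMod}(H)$ to a finitely generated $H$-module. **Proposition 3.2.** Assume that $R$ is noetherian as a left $R^H$-module. Then all finitely generated left $T$-modules are stably finitely generated as $H$-modules if and only if $R^H/\Lambda R$ is finite-dimensional over $k$. -/

import Mathlib

open scoped TensorProduct

universe u v w

section ModuleAlgebra

variable (k : Type u) (H : Type v) (R : Type w)

/-- `R` is a left `H`-module algebra: besides the `k`-algebra structure of `R` and its compatible
left `H`-module structure, one has `h • 1 = ε(h) 1` and `h • (a b) = ∑ (h₁ • a) (h₂ • b)`. -/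
class IsHopfModuleAlgebra [Field k] [Ring H] [HopfAlgebra k H] [Ring R] [Algebra k R]
    [Module H R] [IsScalarTower k H R] : Prop where
  smul_one (h : H) : h • (1 : R) = Coalgebra.counit (R := k) h • (1 : R)
  smul_mul (h : H) (a b : R) : h • (a * b) =
    TensorProduct.lift
      ((LinearMap.mul k R).compl₁₂
        ((Algebra.lsmul k k R).toLinearMap.flip a) ((Algebra.lsmul k k R).toLinearMap.flip b))
      (Coalgebra.comul (R := k) h)

variable [Field k] [Ring H] [HopfAlgebra k H] [Ring R] [Algebra k R]
    [Module H R] [IsScalarTower k H R]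

/-- The defining identity of a module algebra in Sweedler form. -/
theorem IsHopfModuleAlgebra.smul_mul_eq_sum {k : Type u} {H : Type v} {R : Type w} {ι : Type*}
    [Field k] [Ring H] [HopfAlgebra k H] [Ring R] [Algebra k R]
    [Module H R] [IsScalarTower k H R] [IsHopfModuleAlgebra k H R]
    {h : H} (𝓡 : Coalgebra.Repr k h ι) (a b : R) :
    h • (a * b) = ∑ i ∈ 𝓡.index, (𝓡.left i • a) * (𝓡.right i • b) := by
  rw [IsHopfModuleAlgebra.smul_mul (k := k), ← 𝓡.eq]
  simp

/-- The subalgebra `R^H` of `H`-invariants of the module algebra `R`. -/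
def hopfInvariants [IsHopfModuleAlgebra k H R] : Subalgebra k R where
  carrier := {r | ∀ h : H, h • r = Coalgebra.counit (R := k) h • r}
  mul_mem' := by
    intro a b ha hb h
    have 𝓡 := Coalgebra.Repr.arbitrary k h
    rw [IsHopfModuleAlgebra.smul_mul_eq_sum 𝓡]
    have e := congrArg (Coalgebra.counit (R := k)) (Coalgebra.sum_counit_smul 𝓡)
    rw [← e, map_sum, Finset.sum_smul]
    refine Finset.sum_congr rfl fun i _ => ?_
    rw [ha, hb, smul_mul_smul_comm, map_smul, smul_eq_mul]
  add_mem' := by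
    intro a b ha hb h
    rw [smul_add, ha h, hb h, smul_add]
  algebraMap_mem' := by
    intro c h
    rw [Algebra.algebraMap_eq_smul_one, smul_comm, IsHopfModuleAlgebra.smul_one (k := k), smul_comm]

end ModuleAlgebra

section Integral

/-- `Λ` is a left integral of `H`: `h Λ = ε(h) Λ` for all `h`. -/
def IsLeftIntegral (k : Type u) {H : Type v} [Field k] [Ring H] [HopfAlgebra k H] (Λ : H) : Prop :=
  ∀ h : H, h * Λ = Coalgebra.counit (R := k) h • Λ

/-- The `k`-linear map `R → R^H`, `r ↦ Λ • r`, for a left integral `Λ`. Its range is `ΛR`. -/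
def integralMap (k : Type u) {H : Type v} (R : Type w) [Field k] [Ring H] [HopfAlgebra k H]
    [Ring R] [Algebra k R] [Module H R] [IsScalarTower k H R] [IsHopfModuleAlgebra k H R]
    {Λ : H} (hΛ : IsLeftIntegral k Λ) : R →ₗ[k] hopfInvariants k H R where
  toFun r := ⟨Λ • r, fun h => by rw [← mul_smul, hΛ h, smul_assoc]⟩
  map_add' a b := Subtype.ext (smul_add Λ a b)
  map_smul' c a := Subtype.ext (smul_comm Λ c a)

end Integral

section Smash

/-- The underlying space `R ⊗ H` of the smash product `R # H`. -/
def SmashProduct (k : Type u) (H : Type v) (R : Type w) [Field k] [Ring H] [HopfAlgebra k H]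
    [Ring R] [Algebra k R] : Type (max w v) :=
  R ⊗[k] H

namespace SmashProduct

variable {k : Type u} {H : Type v} {R : Type w} [Field k] [Ring H] [HopfAlgebra k H]
    [Ring R] [Algebra k R]

noncomputable instance : AddCommGroup (SmashProduct k H R) :=
  inferInstanceAs (AddCommGroup (R ⊗[k] H))

noncomputable instance : Module k (SmashProduct k H R) :=
  inferInstanceAs (Module k (R ⊗[k] H))

/-- The element `r # h`. -/
noncomputable def mk (r : R) (h : H) : SmashProduct k H R := r ⊗ₜ[k] h

/-- Left multiplication by `r` on the first factor of `R ⊗ H`. -/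
noncomputable def leftMul : R →ₐ[k] Module.End k (R ⊗[k] H) :=
  (Module.End.rTensorAlgHom k R H).comp (Algebra.lmul k R)

theorem leftMul_tmul (r a : R) (h : H) :
    leftMul (k := k) (H := H) r (a ⊗ₜ[k] h) = (r * a) ⊗ₜ[k] h := rfl

variable [Module H R] [IsScalarTower k H R]

/-- The diagonal action `h • (r ⊗ h') = ∑ (h₁ • r) ⊗ h₂ h'` on `R ⊗ H`. -/
noncomputable def diagAct : H →ₐ[k] Module.End k (R ⊗[k] H) :=
  (Module.endTensorEndAlgHom (R := k) (A := k) (M := R) (N := H)).comp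
    ((Algebra.TensorProduct.map (Algebra.lsmul k k R) (Algebra.lmul k H)).comp
      (Bialgebra.comulAlgHom k H))

/-- The multiplication `(r # h) (r' # h') = ∑ r (h₁ • r') # h₂ h'` as a bilinear map. -/
noncomputable def mulMap :
    (R ⊗[k] H) →ₗ[k] (R ⊗[k] H) →ₗ[k] (R ⊗[k] H) :=
  TensorProduct.lift
    ((LinearMap.mul k (Module.End k (R ⊗[k] H))).compl₁₂
      (leftMul (k := k) (H := H) (R := R)).toLinearMap
      (diagAct (k := k) (H := H) (R := R)).toLinearMap)

theorem diagAct_tmul {ι : Type*} {h : H} (𝓡 : Coalgebra.Repr k h ι) (a : R) (g : H) :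
    diagAct (k := k) (R := R) h (a ⊗ₜ[k] g) =
      ∑ i ∈ 𝓡.index, (𝓡.left i • a) ⊗ₜ[k] (𝓡.right i * g) := by
  simp only [diagAct, AlgHom.comp_apply, Bialgebra.comulAlgHom_apply]
  rw [← 𝓡.eq, map_sum, map_sum, LinearMap.sum_apply]
  rfl

theorem mulMap_tmul (r : R) (h : H) (x : R ⊗[k] H) :
    mulMap (r ⊗ₜ[k] h) x = leftMul (k := k) r (diagAct (k := k) h x) := by
  simp [mulMap]

noncomputable instance : Mul (SmashProduct k H R) where
  mul x y := (mulMap (k := k) (H := H) (R := R) x y : R ⊗[k] H)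

noncomputable instance : One (SmashProduct k H R) := ⟨mk 1 1⟩

theorem mul_def (x y : SmashProduct k H R) :
    x * y = (mulMap (k := k) (H := H) (R := R) x y : R ⊗[k] H) := rfl

/-- The multiplication rule of the smash product in Sweedler form. -/
theorem mk_mul_mk {ι : Type*} (r r' : R) {h : H} (𝓡 : Coalgebra.Repr k h ι) (h' : H) :
    (mk r h * mk r' h' : SmashProduct k H R) =
      ∑ i ∈ 𝓡.index, mk (r * (𝓡.left i • r')) (𝓡.right i * h') := by
  change mulMap (k := k) (r ⊗ₜ[k] h) (r' ⊗ₜ[k] h') =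
    ∑ i ∈ 𝓡.index, (r * (𝓡.left i • r')) ⊗ₜ[k] (𝓡.right i * h')
  rw [mulMap_tmul, diagAct_tmul 𝓡, map_sum]
  simp only [leftMul_tmul]

theorem leftMul_mulMap (r : R) (x y : R ⊗[k] H) :
    leftMul (k := k) r (mulMap x y) = mulMap (leftMul (k := k) r x) y := by
  induction x with
  | zero => simp
  | add x x' hx hx' => simp only [map_add, LinearMap.add_apply, hx, hx']
  | tmul a g => rw [mulMap_tmul, leftMul_tmul, mulMap_tmul, map_mul, Module.End.mul_apply]

theorem one_mulMap (x : R ⊗[k] H) : mulMap ((1 : R) ⊗ₜ[k] (1 : H)) x = x := by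
  rw [mulMap_tmul, map_one, map_one, Module.End.one_apply, Module.End.one_apply]

variable [IsHopfModuleAlgebra k H R]

theorem diagAct_leftMul {ι : Type*} {h : H} (𝓡 : Coalgebra.Repr k h ι) (r : R) (x : R ⊗[k] H) :
    diagAct (k := k) h (leftMul (k := k) r x) =
      ∑ i ∈ 𝓡.index,
        leftMul (k := k) (𝓡.left i • r) (diagAct (k := k) (𝓡.right i) x) := by
  induction x with
  | zero => simp
  | add x y hx hy => simp only [map_add, hx, hy, Finset.sum_add_distrib]
  | tmul a g =>
    have key := congrArg
      (TensorProduct.map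
          (TensorProduct.lift
            ((LinearMap.mul k R).compl₁₂ ((Algebra.lsmul k k R).toLinearMap.flip r)
              ((Algebra.lsmul k k R).toLinearMap.flip a)))
          ((LinearMap.mul k H).flip g) ∘ₗ (TensorProduct.assoc k H H H).symm.toLinearMap)
      (Coalgebra.sum_tmul_tmul_eq 𝓡
        (fun i => Coalgebra.Repr.arbitrary k (𝓡.left i))
        (fun i => Coalgebra.Repr.arbitrary k (𝓡.right i)))
    simp only [map_sum, LinearMap.comp_apply, LinearEquiv.coe_coe, TensorProduct.assoc_symm_tmul,
      TensorProduct.map_tmul, TensorProduct.lift.tmul, LinearMap.compl₁₂_apply,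
      LinearMap.flip_apply, AlgHom.toLinearMap_apply, Algebra.lsmul_coe,
      LinearMap.mul_apply'] at key
    rw [leftMul_tmul, diagAct_tmul 𝓡]
    simp only [IsHopfModuleAlgebra.smul_mul_eq_sum (Coalgebra.Repr.arbitrary k _),
      diagAct_tmul (Coalgebra.Repr.arbitrary k _), TensorProduct.sum_tmul, map_sum, leftMul_tmul]
    exact key

theorem diagAct_mulMap (h : H) (x y : R ⊗[k] H) :
    diagAct (k := k) h (mulMap x y) = mulMap (diagAct (k := k) h x) y := by
  induction x with
  | zero => simp
  | add x x' hx hx' => simp only [map_add, LinearMap.add_apply, hx, hx']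
  | tmul a g =>
    have 𝓡 := Coalgebra.Repr.arbitrary k h
    rw [mulMap_tmul, diagAct_leftMul 𝓡, diagAct_tmul 𝓡, map_sum, LinearMap.sum_apply]
    refine Finset.sum_congr rfl fun i _ => ?_
    rw [mulMap_tmul, map_mul, Module.End.mul_apply]

theorem mulMap_assoc (x y z : R ⊗[k] H) :
    mulMap (mulMap x y) z = mulMap x (mulMap y z) := by
  induction x with
  | zero => simp
  | add x x' hx hx' => simp only [map_add, LinearMap.add_apply, hx, hx']
  | tmul a g =>
    rw [mulMap_tmul, mulMap_tmul, diagAct_mulMap, leftMul_mulMap]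

theorem mulMap_one (x : R ⊗[k] H) : mulMap x ((1 : R) ⊗ₜ[k] (1 : H)) = x := by
  induction x with
  | zero => simp
  | add x x' hx hx' => simp only [map_add, LinearMap.add_apply, hx, hx']
  | tmul a g =>
    have 𝓡 := Coalgebra.Repr.arbitrary k g
    rw [mulMap_tmul, diagAct_tmul 𝓡]
    simp only [IsHopfModuleAlgebra.smul_one (k := k), map_sum, leftMul_tmul, mul_one,
      TensorProduct.smul_tmul]
    rw [← TensorProduct.tmul_sum, Coalgebra.sum_counit_smul 𝓡]

noncomputable instance : Ring (SmashProduct k H R) where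
  __ := (inferInstance : AddCommGroup (SmashProduct k H R))
  __ := (inferInstance : Mul (SmashProduct k H R))
  __ := (inferInstance : One (SmashProduct k H R))
  mul_assoc x y z := mulMap_assoc x y z
  one_mul x := one_mulMap x
  mul_one x := mulMap_one x
  left_distrib x y z := map_add (mulMap (k := k) (H := H) (R := R) x) y z
  right_distrib x y z := LinearMap.map_add₂ (mulMap (k := k) (H := H) (R := R)) x y z
  zero_mul x := LinearMap.map_zero₂ (mulMap (k := k) (H := H) (R := R)) x
  mul_zero x := map_zero (mulMap (k := k) (H := H) (R := R) x)

noncomputable instance : Algebra k (SmashProduct k H R) :=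
  Algebra.ofModule
    (fun c x y => LinearMap.map_smul₂ (mulMap (k := k) (H := H) (R := R)) c x y)
    (fun c x y => map_smul (mulMap (k := k) (H := H) (R := R) x) c y)

variable (k H R) in
/-- The inclusion `H → R # H`, `h ↦ 1 # h`. -/
noncomputable def inclH : H →ₐ[k] SmashProduct k H R :=
  AlgHom.ofLinearMap
    (TensorProduct.mk k R H 1 : H →ₗ[k] R ⊗[k] H) rfl (by
      intro g h
      have 𝓡 := Coalgebra.Repr.arbitrary k g
      refine Eq.trans ?_ (mk_mul_mk (1 : R) 1 𝓡 h).symm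
      simp only [IsHopfModuleAlgebra.smul_one (k := k), one_mul]
      change (1 : R) ⊗ₜ[k] (g * h) = ∑ i ∈ 𝓡.index, _ ⊗ₜ[k] _
      simp only [TensorProduct.smul_tmul]
      rw [← TensorProduct.tmul_sum]
      simp only [← smul_mul_assoc]
      rw [← Finset.sum_mul, Coalgebra.sum_counit_smul 𝓡])

theorem inclH_apply (h : H) : inclH k H R h = mk 1 h := rfl

end SmashProduct
end Smash

section Stable

open CategoryTheory

variable {S : Type v} [Ring S]

/-- An `S`-linear map that factors through a projective `S`-module. -/
def FactorsThroughProjective {M N : ModuleCat.{max v w} S} (f : M ⟶ N) : Prop :=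
  ∃ (P : ModuleCat.{max v w} S) (a : M ⟶ P) (b : P ⟶ N), Module.Projective S P ∧ a ≫ b = f

variable (S) in
/-- Two `S`-linear maps are equivalent if their difference factors through a projective module. -/
def stableRel : HomRel (ModuleCat.{max v w} S) :=
  fun _ _ f g => FactorsThroughProjective.{v, w} (f - g)

instance : Congruence (stableRel.{v, w} S) where
  comp_left f g g' := by
    rintro ⟨P, a, b, hP, h⟩
    exact ⟨P, f ≫ a, b, hP, by rw [Category.assoc, h, Preadditive.comp_sub]⟩
  comp_right g h := by
    obtain ⟨P, a, b, hP, h⟩ := h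
    exact ⟨P, a, b ≫ g, hP, by rw [← Category.assoc, h, Preadditive.sub_comp]⟩
  equivalence :=
    { refl := fun f => ⟨ModuleCat.of S PUnit, 0, 0, inferInstance, by simp⟩
      symm := by
        rintro f g ⟨P, a, b, hP, h⟩
        exact ⟨P, a, -b, hP, by rw [Preadditive.comp_neg, h, neg_sub]⟩
      trans := by
        rintro f g h ⟨P, a, b, hP, e⟩ ⟨P', a', b', hP', e'⟩
        refine ⟨ModuleCat.of S (P × P'), ModuleCat.ofHom (a.hom.prod a'.hom),
          ModuleCat.ofHom (b.hom.coprod b'.hom), inferInstance, ?_⟩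
        rw [← sub_add_sub_cancel f g h, ← e, ← e']
        ext x
        simp }

variable (S) in
/-- The stable module category `StMod(S)`. -/
abbrev StMod := CategoryTheory.Quotient (stableRel.{v, w} S)

variable (S) in
/-- The functor `Mod(S) ⥤ StMod(S)`, the identity on objects. -/
abbrev toStMod : ModuleCat.{max v w} S ⥤ StMod.{v, w} S :=
  CategoryTheory.Quotient.functor (stableRel.{v, w} S)

theorem toStMod_map_eq_iff {M N : ModuleCat.{max v w} S} (f g : M ⟶ N) :
    (toStMod.{v, w} S).map f = (toStMod S).map g ↔ FactorsThroughProjective.{v, w} (f - g) :=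
  CategoryTheory.Quotient.functor_map_eq_iff _ f g

/-- `M` is stably finitely generated: it is isomorphic in `StMod(S)` to a finitely generated
module. -/
def IsStablyFG (M : ModuleCat.{max v w} S) : Prop :=
  ∃ N : ModuleCat.{max v w} S, Module.Finite S N ∧
    Nonempty ((toStMod.{v, w} S).obj M ≅ (toStMod.{v, w} S).obj N)

end Stable

/-! Write `T = R # H` and let `soc` mean the elements killed by the Jacobson radical of `H`. By
Larson–Sweedler, `Λ₁` and `S(Λ₂)` are dual bases, so `H` is Frobenius and free modules are
injective.

If `R^H / ΛR` is finite-dimensional and `M` is a finitely generated `T`-module, then `M` is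
noetherian over `R^H`, which commutes with `H`; hence `soc M` is finitely generated over `R^H`. In
`T` one has `Λ • r = ∑ Λ₁ r S(Λ₂)`, and `m ↦ ∑ Λ₁ ⊗ S(Λ₂) m` is `H`-linear, so `ΛR` maps `soc M`
into `soc(H) M` (`inclR_integral_smul_mem_socleSpan`). Thus `soc M` is finite-dimensional modulo
`soc(H) M`. A projective direct summand of `M` absorbs `soc(H) M`; its complement has
finite-dimensional socle and is therefore finitely generated
(`FrobeniusSystem.exists_isCompl_projective_finite`).

Conversely, take `M = T(1 # Λ)`, a copy of `R`. Its identity is `βα + ba` with `α` into a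
finite-dimensional `N` and `a` into a projective `P`. Invariants of `P` lie in `ΛP`, so an invariant
`c` with `α(c) ∈ ΛN` lies in `ΛR`. Hence `R^H / ΛR` is a quotient of a subspace of `N / ΛN`. -/

/-- Dual bases `a i`, `b i` of the algebra `A` with respect to a linear form. -/
structure FrobeniusSystem (k : Type u) (A : Type v) [Field k] [Ring A] [Algebra k A]
    (ι : Type*) where
  /-- the index set of the dual bases -/
  index : Finset ι
  /-- the first dual basis -/
  left : ι → A
  /-- the second dual basis -/
  right : ι → A
  /-- the Frobenius form -/
  form : A →ₗ[k] k
  casimir_comm (x : A) :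
    ∑ i ∈ index, (x * left i) ⊗ₜ[k] right i = ∑ i ∈ index, left i ⊗ₜ[k] (right i * x)
  sum_form_right (x : A) : ∑ i ∈ index, form (right i * x) • left i = x
  sum_form_left (x : A) : ∑ i ∈ index, form (x * left i) • right i = x

/-! ### Integrals and the Frobenius structure of `H`. -/

section LarsonSweedler

open Coalgebra HopfAlgebra

variable {k : Type u} {H : Type v} [Field k] [Ring H] [HopfAlgebra k H] {Λ : H} {ι : Type*}

theorem Coalgebra.sum_counit_right_smul {a : H} (𝓡 : Repr k a ι) :
    ∑ j ∈ 𝓡.index, counit (R := k) (𝓡.right j) • 𝓡.left j = a := by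
  simpa only [map_sum, _root_.TensorProduct.rid_tmul, one_smul] using
    congrArg (_root_.TensorProduct.rid k H) (sum_tmul_counit_eq 𝓡)

/-- `∑ h Λ₁ ⊗ S(Λ₂) = ∑ Λ₁ ⊗ S(Λ₂) h`. -/
theorem IsLeftIntegral.casimir_comm (hΛ : IsLeftIntegral k Λ) (𝓡 : Repr k Λ ι) (h : H) :
    ∑ i ∈ 𝓡.index, (h * 𝓡.left i) ⊗ₜ[k] antipode k (𝓡.right i) =
      ∑ i ∈ 𝓡.index, 𝓡.left i ⊗ₜ[k] (antipode k (𝓡.right i) * h) := by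
  have 𝓢 := Repr.arbitrary k h
  have 𝓢l := fun j => Repr.arbitrary k (𝓢.left j)
  have 𝓢r := fun j => Repr.arbitrary k (𝓢.right j)
  -- Evaluate `(id ⊗ S)((h₁ ⊗ h₂) Δ(Λ)) (1 ⊗ h₃)` with both bracketings: `h₁Λ = ε(h₁)Λ` gives one
  -- side, `S(h₂Λ₂)h₃ = S(Λ₂)S(h₂)h₃` the other.
  have key := congrArg
    (TensorProduct.lift
      ((LinearMap.mul k (H ⊗[k] H)).compl₁₂
        (TensorProduct.map LinearMap.id (antipode k) ∘ₗ
          (LinearMap.mul k (H ⊗[k] H)).flip (comul (R := k) Λ))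
        (TensorProduct.mk k H H 1)) ∘ₗ (TensorProduct.assoc k H H H).symm.toLinearMap)
    (sum_tmul_tmul_eq 𝓢 𝓢l 𝓢r)
  simp only [map_sum, LinearMap.comp_apply, LinearEquiv.coe_coe, TensorProduct.assoc_symm_tmul,
    TensorProduct.lift.tmul, LinearMap.compl₁₂_apply, LinearMap.flip_apply,
    LinearMap.mul_apply', TensorProduct.mk_apply] at key
  have lhs : ∀ j, ∑ x ∈ (𝓢l j).index,
      (TensorProduct.map LinearMap.id (antipode k)) (((𝓢l j).left x ⊗ₜ[k] (𝓢l j).right x) *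
        comul (R := k) Λ) * (1 ⊗ₜ[k] 𝓢.right j) =
      ∑ i ∈ 𝓡.index, 𝓡.left i ⊗ₜ[k] (antipode k (𝓡.right i) *
        (counit (R := k) (𝓢.left j) • 𝓢.right j)) := by
    intro j
    rw [← Finset.sum_mul, ← map_sum, ← Finset.sum_mul, (𝓢l j).eq, ← Bialgebra.comul_mul,
      hΛ, map_smul, map_smul, ← 𝓡.eq, map_sum, Finset.smul_sum, Finset.sum_mul]
    simp
  have rhs : ∀ j, ∑ x ∈ (𝓢r j).index,
      (TensorProduct.map LinearMap.id (antipode k)) ((𝓢.left j ⊗ₜ[k] (𝓢r j).left x) *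
        comul (R := k) Λ) * (1 ⊗ₜ[k] (𝓢r j).right x) =
      ∑ i ∈ 𝓡.index, ((counit (R := k) (𝓢.right j) • 𝓢.left j) * 𝓡.left i) ⊗ₜ[k]
        antipode k (𝓡.right i) := by
    intro j
    simp only [← 𝓡.eq, Finset.mul_sum, map_sum, Finset.sum_mul,
      Algebra.TensorProduct.tmul_mul_tmul, TensorProduct.map_tmul, LinearMap.id_apply, mul_one,
      antipode_mul_antidistrib]
    rw [Finset.sum_comm]
    refine Finset.sum_congr rfl fun i _ => ?_
    simp only [mul_assoc]
    rw [← TensorProduct.tmul_sum, ← Finset.mul_sum, sum_antipode_mul_eq_smul]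
    simp [TensorProduct.tmul_smul, TensorProduct.smul_tmul']
  simp only [lhs, rhs] at key
  rw [Finset.sum_comm, Finset.sum_comm (s := 𝓢.index)] at key
  simp only [← TensorProduct.tmul_sum, ← TensorProduct.sum_tmul, ← Finset.mul_sum,
    ← Finset.sum_mul] at key
  rw [sum_counit_smul 𝓢] at key
  rw [sum_counit_right_smul 𝓢] at key
  exact key.symm

/-- The linear map `f ↦ ∑ f(S(Λ₂)) Λ₁` from the dual of `H` to `H`. -/
noncomputable def integralDual (𝓡 : Repr k Λ ι) : (H →ₗ[k] k) →ₗ[k] H where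
  toFun f := ∑ i ∈ 𝓡.index, f (antipode k (𝓡.right i)) • 𝓡.left i
  map_add' f g := by simp [add_smul, Finset.sum_add_distrib]
  map_smul' c f := by simp [Finset.smul_sum, mul_smul]

theorem integralDual_apply (𝓡 : Repr k Λ ι) (f : H →ₗ[k] k) :
    integralDual 𝓡 f = ∑ i ∈ 𝓡.index, f (antipode k (𝓡.right i)) • 𝓡.left i := rfl

/-- The Casimir identity, read as left `H`-linearity for the action `(h f)(x) = f(xh)` on the dual.
-/
theorem IsLeftIntegral.integralDual_mulRight (hΛ : IsLeftIntegral k Λ) (𝓡 : Repr k Λ ι)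
    (f : H →ₗ[k] k) (h : H) :
    integralDual 𝓡 (f ∘ₗ (LinearMap.mul k H).flip h) = h * integralDual 𝓡 f := by
  have := congrArg (TensorProduct.lift ((LinearMap.lsmul k H).flip.compl₂ f))
    (hΛ.casimir_comm 𝓡 h)
  simp only [map_sum, TensorProduct.lift.tmul, LinearMap.compl₂_apply, LinearMap.flip_apply,
    LinearMap.lsmul_apply] at this
  simpa [integralDual_apply, Finset.mul_sum] using this.symm

/-- The hypothesis passes to all translates `f(· h)`, so it suffices that it forces `g(1) = 0`. For
this, compute `∑ g(S(Λ₃) S²(Λ₂)) Λ₁` twice. Since `S(Λ₃) S²(Λ₂) = S(S(Λ₂)Λ₃)`, it is `g(1)Λ`. It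
also vanishes, by the translates along a basis. Bijectivity of `S` is not needed. -/
theorem IsLeftIntegral.form_eq_zero [FiniteDimensional k H] (hΛ : IsLeftIntegral k Λ)
    (hΛ0 : Λ ≠ 0) (𝓡 : Repr k Λ ι) (f : H →ₗ[k] k)
    (hf : ∑ i ∈ 𝓡.index, f (antipode k (𝓡.right i)) • 𝓡.left i = 0) : f = 0 := by
  have shift (g : H →ₗ[k] k)
      (hg : ∑ i ∈ 𝓡.index, g (antipode k (𝓡.right i)) • 𝓡.left i = 0) (h : H) :
      ∑ i ∈ 𝓡.index, g (antipode k (𝓡.right i) * h) • 𝓡.left i = 0 := by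
    simpa [integralDual_apply, hg] using hΛ.integralDual_mulRight 𝓡 g h
  have at_one : ∀ (g : H →ₗ[k] k),
      ∑ i ∈ 𝓡.index, g (antipode k (𝓡.right i)) • 𝓡.left i = 0 → g 1 = 0 := by
    intro g hg
    have 𝓢l := fun j => Repr.arbitrary k (𝓡.left j)
    have 𝓢r := fun j => Repr.arbitrary k (𝓡.right j)
    have key := congrArg
      (TensorProduct.lift ((LinearMap.lsmul k H).flip.compl₂
        (g ∘ₗ antipode k ∘ₗ LinearMap.mul' k H ∘ₗ (antipode k).rTensor H)))
      (sum_tmul_tmul_eq 𝓡 𝓢l 𝓢r)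
    simp only [map_sum, TensorProduct.lift.tmul, LinearMap.compl₂_apply, LinearMap.flip_apply,
      LinearMap.lsmul_apply, LinearMap.comp_apply, LinearMap.rTensor_tmul, LinearMap.mul'_apply,
      antipode_mul_antidistrib (R := k)] at key
    have lhs : ∑ i ∈ 𝓡.index, ∑ j ∈ (𝓢l i).index,
        g (antipode k (𝓡.right i) * antipode k (antipode k ((𝓢l i).right j))) •
          (𝓢l i).left j = 0 := by
      let e := Module.finBasis k H
      -- The `e l`-coordinate of `S²(Λ₂)` is extracted after applying `Δ` to the vanishing sum for
      -- the translate by `e l`.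
      have hl : ∀ l, ∑ i ∈ 𝓡.index, ∑ j ∈ (𝓢l i).index,
          (g (antipode k (𝓡.right i) * e l) *
            e.repr (antipode k (antipode k ((𝓢l i).right j))) l) • (𝓢l i).left j = 0 := by
        intro l
        have := congrArg (TensorProduct.lift ((LinearMap.lsmul k H).flip.compl₂
            (e.coord l ∘ₗ antipode k ∘ₗ antipode k)) ∘ₗ comul (R := k)) (shift g hg (e l))
        simp only [map_sum, map_smul, map_zero, LinearMap.comp_apply, ← (𝓢l _).eq,
          TensorProduct.lift.tmul, LinearMap.compl₂_apply, LinearMap.flip_apply,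
          LinearMap.lsmul_apply, Finset.smul_sum, smul_smul, Module.Basis.coord_apply] at this
        exact this
      have hs := Finset.sum_eq_zero (s := Finset.univ) fun l _ => hl l
      rw [← hs, Finset.sum_comm]
      refine Finset.sum_congr rfl fun i _ => ?_
      rw [Finset.sum_comm]
      refine Finset.sum_congr rfl fun j _ => ?_
      rw [← Finset.sum_smul]
      congr 1
      conv_lhs => rw [← e.sum_repr (antipode k (antipode k ((𝓢l i).right j)))]
      simp only [Finset.mul_sum, map_sum, mul_smul_comm, map_smul, smul_eq_mul]
      exact Finset.sum_congr rfl fun l _ => mul_comm _ _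
    rw [lhs] at key
    have rhs : ∀ i, ∑ j ∈ (𝓢r i).index,
        g (antipode k ((𝓢r i).right j) * antipode k (antipode k ((𝓢r i).left j))) • 𝓡.left i =
        g 1 • counit (R := k) (𝓡.right i) • 𝓡.left i := by
      intro i
      simp only [← antipode_mul_antidistrib (R := k)]
      rw [← Finset.sum_smul, ← map_sum, ← map_sum, sum_antipode_mul_eq_smul, map_smul,
        antipode_one, map_smul, smul_eq_mul, mul_comm, mul_smul]
    simp only [rhs] at key
    rw [← Finset.smul_sum, sum_counit_right_smul 𝓡] at key
    exact (smul_eq_zero.mp key.symm).resolve_right hΛ0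
  ext h
  simpa using at_one (f ∘ₗ (LinearMap.mul k H).flip h) (by simpa using shift f hf h)

theorem IsLeftIntegral.integralDual_injective [FiniteDimensional k H] (hΛ : IsLeftIntegral k Λ)
    (hΛ0 : Λ ≠ 0) (𝓡 : Repr k Λ ι) : Function.Injective (integralDual 𝓡) :=
  (injective_iff_map_eq_zero _).mpr fun f hf => hΛ.form_eq_zero hΛ0 𝓡 f hf

theorem IsLeftIntegral.integralDual_surjective [FiniteDimensional k H] (hΛ : IsLeftIntegral k Λ)
    (hΛ0 : Λ ≠ 0) (𝓡 : Repr k Λ ι) : Function.Surjective (integralDual 𝓡) :=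
  (LinearMap.injective_iff_surjective_of_finrank_eq_finrank
    (Subspace.dual_finrank_eq (K := k) (V := H))).mp (hΛ.integralDual_injective hΛ0 𝓡)

/-- A nonzero left integral makes a finite-dimensional Hopf algebra into a Frobenius algebra. -/
theorem IsLeftIntegral.exists_frobeniusSystem [FiniteDimensional k H] (hΛ : IsLeftIntegral k Λ)
    (hΛ0 : Λ ≠ 0) (𝓡 : Repr k Λ ι) : ∃ 𝓕 : FrobeniusSystem k H ι,
      𝓕.index = 𝓡.index ∧ 𝓕.left = 𝓡.left ∧ ∀ i, 𝓕.right i = antipode k (𝓡.right i) := by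
  obtain ⟨lam, hlam⟩ := hΛ.integralDual_surjective hΛ0 𝓡 1
  have h1 (h : H) : integralDual 𝓡 (lam ∘ₗ (LinearMap.mul k H).flip h) = h := by
    rw [hΛ.integralDual_mulRight, hlam, mul_one]
  refine ⟨⟨𝓡.index, 𝓡.left, fun i => antipode k (𝓡.right i), lam, hΛ.casimir_comm 𝓡,
    fun h => by simpa [integralDual_apply] using h1 h, fun h => ?_⟩, rfl, rfl, fun _ => rfl⟩
  -- Injectivity also gives `f = lam(· Φ(f))` for `Φ = integralDual 𝓡`; evaluated at `h`, this is
  -- the second dual basis identity after applying an arbitrary `f`.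
  refine (Module.forall_dual_apply_eq_zero_iff k _).mp (fun f => ?_) |> sub_eq_zero.mp
  have := hΛ.integralDual_injective hΛ0 𝓡 (h1 (integralDual 𝓡 f))
  have := LinearMap.congr_fun this h
  rw [map_sub, ← this, sub_eq_zero]
  simp [integralDual_apply, mul_comm]

/-- The space of left integrals is one-dimensional. -/
theorem IsLeftIntegral.exists_eq_smul [FiniteDimensional k H] (hΛ : IsLeftIntegral k Λ)
    (hΛ0 : Λ ≠ 0) {x : H} (hx : IsLeftIntegral k x) : ∃ c : k, x = c • Λ := by
  have 𝓡 := Repr.arbitrary k Λ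
  obtain ⟨f, rfl⟩ := hΛ.integralDual_surjective hΛ0 𝓡 x
  refine ⟨f 1, ?_⟩
  have hf : f = f 1 • counit (R := k) := by
    ext h
    have : f ∘ₗ (LinearMap.mul k H).flip h = counit (R := k) h • f :=
      hΛ.integralDual_injective hΛ0 𝓡 (by rw [hΛ.integralDual_mulRight, hx, map_smul])
    simpa [mul_comm] using LinearMap.congr_fun this 1
  have e : integralDual 𝓡 (counit (R := k)) = Λ := by
    rw [integralDual_apply]
    simpa using sum_counit_right_smul 𝓡
  conv_lhs => rw [hf, map_smul, e]

/-- The invariants of a projective `H`-module are the multiples of the integral. -/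
theorem IsLeftIntegral.exists_smul_eq_of_projective [FiniteDimensional k H]
    (hΛ : IsLeftIntegral k Λ) (hΛ0 : Λ ≠ 0) {P : Type*} [AddCommGroup P] [Module H P]
    [Module.Projective H P] {x : P}
    (hx : ∀ h : H, h • x = algebraMap k H (counit (R := k) h) • x) : ∃ y : P, Λ • y = x := by
  obtain ⟨s, hs⟩ := Module.projective_def'.mp ‹Module.Projective H P›
  have hc : ∀ p, ∃ c : k, s x p = c • Λ := fun p =>
    hΛ.exists_eq_smul hΛ0 fun h => by
      have := congrArg (fun z => s z p) (hx h)
      simpa [Algebra.smul_def] using this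
  choose c hc using hc
  -- The coordinates of `s x` in the free module are left integrals `c p • Λ`. Hence `s x = Λ • c`,
  -- and the image of `c` in `P` is the witness.
  refine ⟨Finsupp.linearCombination H id
    (Finsupp.onFinset (s x).support (fun p => algebraMap k H (c p)) fun p hp => ?_), ?_⟩
  · rw [Finsupp.mem_support_iff, hc]
    refine smul_ne_zero (fun h0 => hp (by rw [h0, map_zero])) hΛ0
  · rw [← map_smul]
    conv_rhs => rw [← LinearMap.id_apply (R := H) x, ← hs, LinearMap.comp_apply]
    congr 1
    ext p
    simp [hc, Algebra.smul_def, Algebra.commutes]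

end LarsonSweedler

/-! ### Coextension and self-injectivity over a Frobenius algebra. -/

namespace FrobeniusSystem

variable {k : Type u} {A : Type v} {ι : Type*} [Field k] [Ring A] [Algebra k A]
  (𝓕 : FrobeniusSystem k A ι)
  {B X : Type*} [AddCommGroup B] [Module k B] [Module A B] [IsScalarTower k A B]
  [AddCommGroup X] [Module k X]

/-- The `A`-linear map `B → A ⊗ X`, `b ↦ ∑ aᵢ ⊗ φ(bᵢ b)`, attached to a `k`-linear map
`φ : B → X`. -/
noncomputable def coextend (φ : B →ₗ[k] X) : B →ₗ[A] A ⊗[k] X where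
  toFun b := ∑ i ∈ 𝓕.index, 𝓕.left i ⊗ₜ[k] φ (𝓕.right i • b)
  map_add' b c := by simp [TensorProduct.tmul_add, Finset.sum_add_distrib]
  map_smul' x b := by
    have := congrArg (LinearMap.lTensor A (φ ∘ₗ (Algebra.lsmul k k B).toLinearMap.flip b))
      (𝓕.casimir_comm x)
    simpa [mul_smul, Finset.smul_sum, TensorProduct.smul_tmul'] using this.symm

theorem coextend_apply (φ : B →ₗ[k] X) (b : B) :
    𝓕.coextend φ b = ∑ i ∈ 𝓕.index, 𝓕.left i ⊗ₜ[k] φ (𝓕.right i • b) := rfl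

/-- An element of `A ⊗ X` is recovered from the form on its multiples; thus a linear map into `A ⊗
X` is the coextension of its composite with the form. -/
theorem sum_tmul_form_smul (z : A ⊗[k] X) :
    ∑ i ∈ 𝓕.index, 𝓕.left i ⊗ₜ[k] TensorProduct.lid k X (𝓕.form.rTensor X (𝓕.right i • z)) = z := by
  induction z with
  | zero => simp
  | add y z hy hz =>
    conv_rhs => rw [← hy, ← hz]
    simp only [smul_add, map_add, TensorProduct.tmul_add, Finset.sum_add_distrib]
  | tmul a x =>
    conv_rhs => rw [← 𝓕.sum_form_right a, TensorProduct.sum_tmul]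
    refine Finset.sum_congr rfl fun i _ => ?_
    rw [TensorProduct.smul_tmul', LinearMap.rTensor_tmul, TensorProduct.lid_tmul, smul_eq_mul,
      TensorProduct.smul_tmul]

/-- Applying the form to the first factor of `coextend φ y` returns `φ y`, because `∑ form(aᵢ) bᵢ =
1`. -/
theorem coextend_eq_zero {φ : B →ₗ[k] X} {Y : Submodule A B} (hφ : ∀ y ∈ Y, φ y = 0 → y = 0)
    {y : B} (hy : y ∈ Y) (h : 𝓕.coextend φ y = 0) : y = 0 := by
  refine hφ y hy ?_
  have := congrArg ((TensorProduct.lid k X).toLinearMap ∘ₗ 𝓕.form.rTensor X) h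
  simp only [coextend_apply, map_sum, LinearMap.comp_apply, LinearEquiv.coe_coe,
    LinearMap.rTensor_tmul, TensorProduct.lid_tmul, map_zero, ← map_smul] at this
  rw [← map_sum] at this
  have e := congrArg (· • y) (𝓕.sum_form_left 1)
  simp only [one_mul, Finset.sum_smul, one_smul, smul_assoc] at e
  rwa [e] at this

include 𝓕 in
/-- Free modules over a Frobenius algebra are injective. -/
theorem injective_tensorProduct (X : Type w) [AddCommGroup X] [Module k X] :
    Module.Injective A (A ⊗[k] X) where
  out N B _ _ _ _ i hi g := by
    let : Module k N := Module.compHom N (algebraMap k A)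
    let : Module k B := Module.compHom B (algebraMap k A)
    have : IsScalarTower k A N := .of_algebraMap_smul fun _ _ => rfl
    have : IsScalarTower k A B := .of_algebraMap_smul fun _ _ => rfl
    obtain ⟨p, hp⟩ := (i.restrictScalars k).exists_leftInverse_of_injective
      (LinearMap.ker_eq_bot.mpr hi)
    -- Only a `k`-linear retraction `p` of `i` is needed: coextension makes the extended map
    -- `A`-linear.
    refine ⟨𝓕.coextend ((TensorProduct.lid k X).toLinearMap ∘ₗ 𝓕.form.rTensor X ∘ₗ
      g.restrictScalars k ∘ₗ p), fun n => ?_⟩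
    have hp' (n : N) : p (i n) = n := LinearMap.congr_fun hp n
    conv_rhs => rw [← 𝓕.sum_tmul_form_smul (g n)]
    refine Finset.sum_congr rfl fun i _ => ?_
    rw [← map_smul, ← map_smul]
    simp only [LinearMap.comp_apply, hp', LinearEquiv.coe_coe, LinearMap.restrictScalars_apply]

end FrobeniusSystem

/-! ### Maximal disjoint submodules of an injective module. -/

section Complement

variable {A F : Type*} [Ring A] [AddCommGroup F] [Module A F]

theorem Submodule.exists_le_maximal_disjoint {K E : Submodule A F} (h : Disjoint K E) :
    ∃ E', E ≤ E' ∧ Maximal (Disjoint K) E' := by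
  refine zorn_le_nonempty₀ {E | Disjoint K E} (fun c hc hchain y _ => ?_) E h
  exact ⟨sSup c, hchain.directedOn.disjoint_sSup_right.mpr fun b hb => hc hb,
    fun z hz => le_sSup hz⟩

/-- In other words, `K ⊔ E` is essential: by modularity `E ⊔ N` is still disjoint from `K`, so
maximality puts `N` inside `E`. -/
theorem Submodule.eq_bot_of_disjoint_sup {K E N : Submodule A F} (hE : Maximal (Disjoint K) E)
    (hN : Disjoint (K ⊔ E) N) : N = ⊥ := by
  have h := hE.prop.disjoint_sup_right_of_disjoint_sup_left hN
  have hle : N ≤ E := le_sup_right.trans (hE.le_of_ge h le_sup_left)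
  exact le_bot_iff.mp (hN (hle.trans le_sup_right) le_rfl)

/-- A submodule of an injective module that is maximal among the submodules disjoint from a given
one is a retract. -/
theorem Submodule.exists_retraction_of_maximal_disjoint [Module.Injective A F]
    {K E : Submodule A F} (hE : Maximal (Disjoint K) E) :
    ∃ h : F →ₗ[A] E, h ∘ₗ E.subtype = LinearMap.id := by
  -- With `K' ≥ K` maximal disjoint from `E`, extend `E → F` along `E → F / K'`. The range of the
  -- extension contains `E` and is disjoint from `K`, so it equals `E`.
  obtain ⟨K', hK, hK'⟩ := Submodule.exists_le_maximal_disjoint hE.prop.symm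
  obtain ⟨g, hg⟩ := Module.Injective.out (K'.mkQ ∘ₗ E.subtype)
    (LinearMap.ker_eq_bot.mp (by
      rw [LinearMap.ker_comp, K'.ker_mkQ]
      exact Submodule.disjoint_iff_comap_eq_bot.mp hK'.prop)) E.subtype
  have hgE (e : F) (he : e ∈ E) : g (K'.mkQ e) = e := hg ⟨e, he⟩
  -- a submodule `N` containing `K'` whose image meets `K'` only is `K'`
  have key (L : Submodule A F) (hL : L ≤ K') : L.comap (g ∘ₗ K'.mkQ) ≤ K' := by
    refine hK'.le_of_ge (Submodule.disjoint_def.mpr fun x hx hx' => ?_) fun x hx => ?_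
    · have : x ∈ L := by rwa [Submodule.mem_comap, LinearMap.comp_apply, hgE x hx] at hx'
      exact Submodule.disjoint_def.mp hK'.prop x hx (hL this)
    · simp [(Submodule.Quotient.mk_eq_zero K').mpr hx]
  have hrange : LinearMap.range (g ∘ₗ K'.mkQ) ≤ E := by
    refine hE.le_of_ge (Submodule.disjoint_def.mpr ?_) fun e he => ⟨e, hgE e he⟩
    rintro _ hx ⟨y, rfl⟩
    have hy : y ∈ K' := key K' le_rfl (hK hx)
    simp [(Submodule.Quotient.mk_eq_zero K').mpr hy]
  refine ⟨(g ∘ₗ K'.mkQ).codRestrict E fun x => hrange ⟨x, rfl⟩, ?_⟩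
  ext e
  exact hgE e e.2

end Complement

/-! ### The socle over an artinian ring. -/

section Socle

variable (A M : Type*) [Ring A] [AddCommGroup M] [Module A M]

/-- The elements annihilated by the Jacobson radical; over an artinian ring this is the socle. -/
def radicalSocle : Submodule A M where
  carrier := {m | ∀ j ∈ Ring.jacobson A, j • m = 0}
  add_mem' hx hy j hj := by rw [smul_add, hx j hj, hy j hj, add_zero]
  zero_mem' j _ := smul_zero j
  smul_mem' a m hm j hj := by
    rw [← mul_smul]
    exact hm _ (Ideal.mul_mem_right _ _ hj)

variable {A M}

theorem map_mem_radicalSocle {N : Type*} [AddCommGroup N] [Module A N] (f : M →ₗ[A] N) {m : M}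
    (hm : m ∈ radicalSocle A M) : f m ∈ radicalSocle A N := fun j hj => by
  rw [← map_smul, hm j hj, map_zero]

variable [IsArtinianRing A]

/-- The action factors through `A` modulo its radical, a semisimple ring. -/
instance : IsSemisimpleModule A (radicalSocle A M) := by
  have h : Module.IsTorsionBySet A (radicalSocle A M) (Ring.jacobson A) := fun x j =>
    Subtype.ext (x.2 j j.2)
  let := h.module
  exact h.isSemisimpleModule_iff.mp inferInstance

/-- Essential submodules contain the socle: a complement of `K ∩ soc` in the semisimple socle is
disjoint from `K`. -/
theorem radicalSocle_le {K : Submodule A M} (hK : ∀ N, Disjoint K N → N = ⊥) :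
    radicalSocle A M ≤ K := by
  obtain ⟨N, hN⟩ := exists_isCompl (K.comap (radicalSocle A M).subtype)
  have hbot : N = ⊥ := by
    have := hK (N.map (radicalSocle A M).subtype) (Submodule.disjoint_def.mpr ?_)
    · exact Submodule.map_injective_of_injective (Submodule.subtype_injective _)
        (this.trans (Submodule.map_bot _).symm)
    · rintro _ hx ⟨y, hy, rfl⟩
      rw [Submodule.disjoint_def.mp hN.disjoint y hx hy, map_zero]
  have := hN.codisjoint.eq_top
  rw [hbot, sup_bot_eq] at this
  intro x hx
  exact (this ▸ Submodule.mem_top : (⟨x, hx⟩ : radicalSocle A M) ∈ _)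

/-- The socle is essential: a nonzero cyclic submodule contains a simple one, which the radical
annihilates. -/
theorem eq_bot_of_disjoint_radicalSocle {N : Submodule A M} (h : Disjoint (radicalSocle A M) N) :
    N = ⊥ := by
  by_contra hN
  obtain ⟨n, hn, hn0⟩ := N.exists_mem_ne_zero_of_ne_bot hN
  obtain ⟨S, hS, hle⟩ := (eq_bot_or_exists_atom_le (⊤ : Submodule A (A ∙ n))).resolve_left (by
    rw [Submodule.eq_bot_iff]
    exact fun h0 => hn0 (congrArg Subtype.val
      (h0 ⟨n, Submodule.mem_span_singleton_self n⟩ Submodule.mem_top)))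
  have := isSimpleModule_iff_isAtom.mpr hS
  obtain ⟨s, hs, hs0⟩ := S.exists_mem_ne_zero_of_ne_bot hS.1
  refine hs0 (Subtype.ext (Submodule.disjoint_def.mp h s (fun j hj => ?_) ?_))
  · have := Module.mem_annihilator.mp
      (IsSemisimpleModule.jacobson_le_annihilator A S hj) ⟨s, hs⟩
    exact congrArg (fun x : S => (x : M)) this
  · exact (Submodule.span_singleton_le_iff_mem n N).mpr hn s.2

end Socle

/-! ### Splitting off a projective summand. -/

section Decomposition

variable {k : Type u} {A : Type v} {ι : Type*} [Field k] [Ring A] [Algebra k A]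

/-- The span of the products `s m` with `s` in the left socle of `A` and `m` in `M`. -/
def socleSpan (k : Type u) (A : Type v) [Field k] [Ring A] [Algebra k A] (M : Type*)
    [AddCommGroup M] [Module k M] [Module A M] : Submodule k M :=
  Submodule.span k {x | ∃ s ∈ radicalSocle A A, ∃ m : M, s • m = x}

variable {M : Type*} [AddCommGroup M] [Module k M] [Module A M] [IsScalarTower k A M]

omit [Module A M] [IsScalarTower k A M] in
variable (k) in
/-- An element of `A ⊗ M` killed by the radical is a sum of tensors `s ⊗ m` with `s` in the
socle of `A`. -/
theorem mem_radicalSocle_tensorProduct {z : A ⊗[k] M} (hz : z ∈ radicalSocle A (A ⊗[k] M)) :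
    ∃ c : Module.Basis.ofVectorSpaceIndex k M →₀ A, (∀ i, c i ∈ radicalSocle A A) ∧
      c.sum (fun i a => a ⊗ₜ[k] Module.Basis.ofVectorSpace k M i) = z := by
  classical
  set e := Module.Basis.ofVectorSpace k M
  obtain ⟨c, rfl⟩ := (TensorProduct.equivFinsuppOfBasisRight (M := A) e).symm.surjective z
  rw [TensorProduct.equivFinsuppOfBasisRight_symm_apply] at hz ⊢
  refine ⟨c, fun i j hj => ?_, rfl⟩
  have h := hz j hj
  have := TensorProduct.sum_tmul_basis_right_eq_zero e
    (c.mapRange (fun a => j * a) (mul_zero j)) (by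
      rw [Finsupp.sum_mapRange_index (by simp)]
      simpa [Finsupp.sum, Finset.smul_sum, TensorProduct.smul_tmul'] using h)
  simpa using congrArg (fun f => f i) this

/-- A linear map from a projective and injective module to `M` induces a splitting of `M` with a
projective summand that contains the image of the socle. -/
theorem exists_isCompl_projective {A : Type v} {F M : Type w} [Ring A] [IsArtinianRing A]
    [AddCommGroup F] [Module A F] [AddCommGroup M] [Module A M] [Module.Injective A F]
    [Module.Projective A F] (π : F →ₗ[A] M) :
    ∃ P N : Submodule A M, IsCompl P N ∧ Module.Projective A P ∧
      ∀ x ∈ radicalSocle A F, π x ∈ P := by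
  -- `E` is a retract of `F`, hence projective, and `π` is injective on it. Injectivity of `F` then
  -- splits `π(E)` off `M`.
  obtain ⟨E, -, hE⟩ := Submodule.exists_le_maximal_disjoint
    (disjoint_bot_right (a := LinearMap.ker π))
  obtain ⟨h, hh⟩ := Submodule.exists_retraction_of_maximal_disjoint hE
  have hhE (e : E) : h e = e := LinearMap.congr_fun hh e
  let j : E →ₗ[A] M := π ∘ₗ E.subtype
  have hj : Function.Injective j := by
    rw [← LinearMap.ker_eq_bot, LinearMap.ker_comp]
    exact Submodule.disjoint_iff_comap_eq_bot.mp hE.prop.symm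
  obtain ⟨g, hg⟩ := Module.Injective.out j hj E.subtype
  have hρ : (h ∘ₗ g) ∘ₗ j = LinearMap.id := by
    ext e
    simp [hg, hhE]
  have hcompl : IsCompl j.range (h ∘ₗ g).ker := by
    have hρ' (e : E) : h (g (j e)) = e := LinearMap.congr_fun hρ e
    refine ⟨Submodule.disjoint_def.mpr ?_, Submodule.codisjoint_iff_exists_add_eq.mpr fun m =>
      ⟨j (h (g m)), m - j (h (g m)), ⟨_, rfl⟩, ?_, by abel⟩⟩
    · rintro _ ⟨e, rfl⟩ he
      rw [← hρ' e, show h (g (j e)) = 0 from he, map_zero]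
    · simp [hρ']
  have : Module.Projective A E := Module.Projective.of_split E.subtype h hh
  refine ⟨LinearMap.range j, LinearMap.ker (h ∘ₗ g), hcompl,
    Module.Projective.of_equiv (LinearEquiv.ofInjective j hj), fun x hx => ?_⟩
  -- `ker π ⊔ E` is essential, so it contains the socle of `F`, and `π` kills the first component.
  obtain ⟨y, hy, e, he, rfl⟩ := Submodule.mem_sup.mp
    (radicalSocle_le (fun _ => Submodule.eq_bot_of_disjoint_sup hE) hx)
  refine ⟨⟨e, he⟩, ?_⟩
  rw [map_add, LinearMap.mem_ker.mp hy, zero_add]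
  rfl

/-- A module over a Frobenius algebra whose socle is finite-dimensional modulo the image of the
socle of the algebra is the direct sum of a projective module and a finite-dimensional one. -/
theorem FrobeniusSystem.exists_isCompl_projective_finite [FiniteDimensional k A]
    (𝓕 : FrobeniusSystem k A ι) {M : Type max v w} [AddCommGroup M] [Module k M] [Module A M]
    [IsScalarTower k A M] (Y : Submodule k M) [FiniteDimensional k Y]
    (hY : (radicalSocle A M).restrictScalars k ≤ Y ⊔ socleSpan k A M) :
    ∃ P N : Submodule A M, IsCompl P N ∧ Module.Projective A P ∧ Module.Finite A N := by
  have : IsArtinianRing A := IsArtinianRing.of_finite k A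
  have : Module.Injective A (A ⊗[k] M) := 𝓕.injective_tensorProduct M
  let π : A ⊗[k] M →ₗ[A] M := TensorProduct.AlgebraTensorModule.lift
    (LinearMap.toSpanSingleton A (M →ₗ[k] M) LinearMap.id)
  have hπ (a : A) (m : M) : π (a ⊗ₜ m) = a • m := by simp [π]
  obtain ⟨P, N, hcompl, hP, hsoc⟩ := exists_isCompl_projective π
  refine ⟨P, N, hcompl, hP, ?_⟩
  -- the image of the socle of `A` lies in the projective summand
  have hD : socleSpan k A M ≤ P.restrictScalars k := by
    refine Submodule.span_le.mpr ?_
    rintro _ ⟨s, hs, m, rfl⟩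
    exact hπ s m ▸ hsoc _ fun x hx => by
      rw [TensorProduct.smul_tmul', hs x hx, TensorProduct.zero_tmul]
  -- hence the socle of the other summand is finite-dimensional
  let Z : Submodule k M := (radicalSocle A M ⊓ N).restrictScalars k
  have hZfin : FiniteDimensional k Z := by
    let q : M →ₗ[k] M ⧸ socleSpan k A M := (socleSpan k A M).mkQ
    have hle : Z.map q ≤ Y.map q := by
      rintro _ ⟨z, hz, rfl⟩
      obtain ⟨y, hy, d, hd, hyd⟩ := Submodule.mem_sup.mp (hY hz.1)
      refine ⟨y, hy, ?_⟩
      have hd0 : q d = 0 := (Submodule.Quotient.mk_eq_zero _).mpr hd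
      rw [← hyd, map_add, hd0, add_zero]
    have : FiniteDimensional k (Z.map q) := Submodule.finiteDimensional_of_le hle
    refine FiniteDimensional.of_injective
      (q.restrict (p := Z) (q := Z.map q) fun x hx => ⟨x, hx, rfl⟩) ?_
    refine (injective_iff_map_eq_zero _).mpr fun z hz => Subtype.ext ?_
    have hz' : (z : M) ∈ socleSpan k A M :=
      (Submodule.Quotient.mk_eq_zero _).mp (congrArg Subtype.val hz)
    exact Submodule.disjoint_def.mp hcompl.disjoint z (hD hz') z.2.2
  -- Coextending a `k`-linear projection onto the socle `Z` of `N` gives a map `N → A ⊗ Z` that is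
  -- injective on the socle, hence on `N`.
  obtain ⟨p, hp⟩ := Z.subtype.exists_leftInverse_of_injective Z.ker_subtype
  let ψ : N →ₗ[A] A ⊗[k] Z := 𝓕.coextend p ∘ₗ N.subtype
  have hψ : ψ.ker = ⊥ := by
    refine eq_bot_of_disjoint_radicalSocle (Submodule.disjoint_def.mpr fun n hn hn' => ?_)
    have hnZ : (n : M) ∈ radicalSocle A M ⊓ N := ⟨map_mem_radicalSocle N.subtype hn, n.2⟩
    refine Subtype.ext (𝓕.coextend_eq_zero (φ := p) (Y := radicalSocle A M ⊓ N)
      (fun y hy h0 => ?_) hnZ hn')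
    have := LinearMap.congr_fun hp ⟨y, hy⟩
    exact congrArg Subtype.val (this.symm.trans h0)
  have : IsNoetherianRing A := IsNoetherianRing.of_finite k A
  exact Module.Finite.of_injective ψ (LinearMap.ker_eq_bot.mp hψ)

end Decomposition

/-! ### The smash product: commutation rules and the left ideal `R # Λ`. -/

namespace SmashProduct

open Coalgebra HopfAlgebra

variable {k : Type u} {H : Type v} {R : Type w} [Field k] [Ring H] [HopfAlgebra k H]
    [Ring R] [Algebra k R]

@[elab_as_elim]
protected theorem induction_on {p : SmashProduct k H R → Prop} (x : SmashProduct k H R)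
    (mk : ∀ r h, p (mk r h)) (add : ∀ x y, p x → p y → p (x + y)) : p x :=
  TensorProduct.induction_on (motive := p) x
    (by simpa only [SmashProduct.mk, TensorProduct.zero_tmul] using! mk 0 0) mk add

theorem mk_smul_left (c : k) (r : R) (h : H) :
    (mk (c • r) h : SmashProduct k H R) = mk r (c • h) :=
  TensorProduct.smul_tmul c r h

theorem mk_add_left (r s : R) (h : H) :
    (mk (r + s) h : SmashProduct k H R) = mk r h + mk s h :=
  TensorProduct.add_tmul r s h

theorem sum_mk_left {ι : Type*} (s : Finset ι) (r : ι → R) (h : H) :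
    ∑ i ∈ s, (mk (r i) h : SmashProduct k H R) = mk (∑ i ∈ s, r i) h :=
  (TensorProduct.sum_tmul s r h).symm

theorem sum_mk_right {ι : Type*} (s : Finset ι) (r : R) (h : ι → H) :
    ∑ i ∈ s, (mk r (h i) : SmashProduct k H R) = mk r (∑ i ∈ s, h i) :=
  (TensorProduct.tmul_sum r s h).symm

theorem mk_left_injective {Λ : H} (hΛ0 : Λ ≠ 0) :
    Function.Injective fun r : R => (mk r Λ : SmashProduct k H R) := by
  obtain ⟨f, hf⟩ : ∃ f : Module.Dual k H, f Λ ≠ 0 := by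
    by_contra! h
    exact hΛ0 ((Module.forall_dual_apply_eq_zero_iff k Λ).mp h)
  intro r s h
  have := congrArg (TensorProduct.rid k R ∘ f.lTensor R) h
  simpa [mk, hf] using this

variable [Module H R] [IsScalarTower k H R]

theorem mk_one_mul_mk (r a : R) (h : H) :
    (mk r 1 * mk a h : SmashProduct k H R) = mk (r * a) h := by
  change mulMap (k := k) (r ⊗ₜ[k] (1 : H)) (a ⊗ₜ[k] h) = (r * a) ⊗ₜ[k] h
  rw [mulMap_tmul, map_one, Module.End.one_apply, leftMul_tmul]

variable [IsHopfModuleAlgebra k H R]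

variable (k H R) in
/-- The inclusion `R → R # H`, `r ↦ r # 1`. -/
noncomputable def inclR : R →ₐ[k] SmashProduct k H R :=
  AlgHom.ofLinearMap ((TensorProduct.mk k R H).flip 1 : R →ₗ[k] R ⊗[k] H) rfl
    fun r a => (mk_one_mul_mk r a 1).symm

theorem inclR_apply (r : R) : inclR k H R r = mk r 1 := rfl

theorem inclR_mul_inclH (r : R) (h : H) :
    inclR k H R r * inclH k H R h = mk r h := by
  rw [inclR_apply, inclH_apply, mk_one_mul_mk, mul_one]

/-- The elements of `H` commute with the invariants. -/
theorem inclH_mul_inclR {c : R} (hc : c ∈ hopfInvariants k H R) (h : H) :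
    inclH k H R h * inclR k H R c = inclR k H R c * inclH k H R h := by
  have 𝓡 := Repr.arbitrary k h
  rw [inclR_mul_inclH, inclH_apply, inclR_apply, mk_mul_mk 1 c 𝓡]
  simp only [hc _, one_mul, mul_one, mk_smul_left]
  rw [sum_mk_right, sum_counit_smul 𝓡]

/-- `h • r = ∑ h₁ r S(h₂)` in the smash product. -/
theorem inclR_smul {ι : Type*} {h : H} (𝓡 : Repr k h ι) (r : R) :
    inclR k H R (h • r) = ∑ i ∈ 𝓡.index,
      inclH k H R (𝓡.left i) * (inclR k H R r * inclH k H R (antipode k (𝓡.right i))) := by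
  have 𝓢l := fun j => Repr.arbitrary k (𝓡.left j)
  have 𝓢r := fun j => Repr.arbitrary k (𝓡.right j)
  have key := congrArg
    (TensorProduct.map ((Algebra.lsmul k k R).toLinearMap.flip r)
      (LinearMap.mul' k H ∘ₗ (antipode k).lTensor H))
    (sum_tmul_tmul_eq 𝓡 𝓢l 𝓢r)
  simp only [map_sum, TensorProduct.map_tmul, LinearMap.comp_apply, LinearMap.lTensor_tmul,
    LinearMap.mul'_apply, LinearMap.flip_apply, AlgHom.toLinearMap_apply, Algebra.lsmul_coe] at key
  simp only [inclR_mul_inclH]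
  simp only [inclH_apply]
  rw [Finset.sum_congr rfl fun i _ => mk_mul_mk (1 : R) r (𝓢l i) _]
  simp only [one_mul]
  refine Eq.trans ?_ key.symm
  simp only [← TensorProduct.tmul_sum, sum_mul_antipode_eq_smul, ← TensorProduct.smul_tmul,
    ← TensorProduct.sum_tmul, ← smul_assoc, ← Finset.sum_smul, sum_counit_right_smul 𝓡]
  rfl

/-- Since `h₂Λ = ε(h₂)Λ`, the elements `r # Λ` form a copy of the `H`-module `R` inside `R # H`. -/
theorem inclH_mul_mk_integral {Λ : H} (hΛ : IsLeftIntegral k Λ) (h : H) (r : R) :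
    inclH k H R h * mk r Λ = mk (h • r) Λ := by
  have 𝓡 := Repr.arbitrary k h
  rw [inclH_apply, mk_mul_mk 1 r 𝓡]
  simp only [hΛ _, one_mul, ← mk_smul_left, ← smul_assoc]
  rw [sum_mk_left, ← Finset.sum_smul, sum_counit_right_smul 𝓡]

theorem mem_span_mk_integral {Λ : H} (hΛ : IsLeftIntegral k Λ) {x : SmashProduct k H R} :
    x ∈ Submodule.span (SmashProduct k H R) {mk (1 : R) Λ} ↔ ∃ r : R, mk r Λ = x := by
  rw [Submodule.mem_span_singleton]
  constructor
  · rintro ⟨t, rfl⟩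
    induction t using SmashProduct.induction_on with
    | add x y hx hy =>
      obtain ⟨r, hr⟩ := hx
      obtain ⟨s, hs⟩ := hy
      exact ⟨r + s, by rw [mk_add_left, hr, hs, add_smul]⟩
    | mk r h =>
      refine ⟨r * (h • (1 : R)), ?_⟩
      rw [smul_eq_mul, ← inclR_mul_inclH r h, mul_assoc, inclH_mul_mk_integral hΛ, inclR_apply,
        mk_one_mul_mk]
  · rintro ⟨r, rfl⟩
    exact ⟨inclR k H R r, by rw [smul_eq_mul, inclR_apply, mk_one_mul_mk, mul_one]⟩

variable {M : Type*} [AddCommGroup M] [Module (SmashProduct k H R) M]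

/-- A finitely generated `R # H`-module is noetherian over `R^H`. -/
theorem isNoetherian_invariants [FiniteDimensional k H] [IsNoetherian (hopfInvariants k H R) R]
    [Module.Finite (SmashProduct k H R) M] [Module R M]
    (hR : ∀ (r : R) (m : M), r • m = inclR k H R r • m) : IsNoetherian (hopfInvariants k H R) M := by
  have : Module.Finite R M := by
    obtain ⟨n, s, hs⟩ := Module.Finite.exists_fin (R := SmashProduct k H R) (M := M)
    let e := Module.finBasis k H
    -- `R # H` is spanned over `R` by a basis of `H`, so these products generate `M` over `R`.
    let g (p : Fin n × Fin (Module.finrank k H)) : M := inclH k H R (e p.2) • s p.1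
    refine ⟨?_⟩
    convert Submodule.fg_span (R := R) (Set.finite_range g)
    refine (Submodule.eq_top_iff'.mpr fun m => ?_).symm
    obtain ⟨t, rfl⟩ := (Submodule.mem_span_range_iff_exists_fun _).mp
      (hs ▸ Submodule.mem_top : m ∈ Submodule.span _ (Set.range s))
    refine Submodule.sum_mem _ fun i _ => ?_
    induction t i using SmashProduct.induction_on with
    | add x y hx hy => rw [add_smul]; exact add_mem hx hy
    | mk r h =>
      rw [← e.sum_repr h, ← sum_mk_right, Finset.sum_smul]
      refine Submodule.sum_mem _ fun l _ => ?_
      rw [← mk_smul_left, ← inclR_mul_inclH, mul_smul, ← hR]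
      exact Submodule.smul_mem _ _ (Submodule.subset_span ⟨(i, l), rfl⟩)
  obtain ⟨n, f, hf⟩ := Module.Finite.exists_fin' R M
  exact isNoetherian_of_surjective (f.restrictScalars (hopfInvariants k H R))
    (LinearMap.range_eq_top.mpr hf)

variable [Module k M] [IsScalarTower k (SmashProduct k H R) M] [Module H M] [IsScalarTower k H M]

/-- The radical socle of an `R # H`-module is mapped by `ΛR` into the span of the products with
socle elements of `H`. -/
theorem inclR_integral_smul_mem_socleSpan [FiniteDimensional k H] {Λ : H}
    (hΛ : IsLeftIntegral k Λ) (hΛ0 : Λ ≠ 0) (hM : ∀ (h : H) (m : M), h • m = inclH k H R h • m)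
    (r : R) {m : M} (hm : m ∈ radicalSocle H M) :
    inclR k H R (Λ • r) • m ∈ socleSpan k H M := by
  obtain ⟨𝓕, hi, hl, hr⟩ := hΛ.exists_frobeniusSystem hΛ0 (Repr.arbitrary k Λ)
  -- `μ(h ⊗ x) = h r x` sends `∑ Λ₁ ⊗ S(Λ₂) m` to `(Λ • r) m`, while `H`-linearity puts that tensor
  -- in the socle of `H ⊗ M`.
  let μ : H ⊗[k] M →ₗ[k] M := TensorProduct.lift
    ((Algebra.lsmul k k M).toLinearMap.compl₂
      (Algebra.lsmul k k M (inclR k H R r)))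
  have hμ (h : H) (x : M) : μ (h ⊗ₜ x) = h • inclR k H R r • x := rfl
  have hz := map_mem_radicalSocle (𝓕.coextend (LinearMap.id (R := k))) hm
  obtain ⟨c, hc, hcz⟩ := mem_radicalSocle_tensorProduct k hz
  have : inclR k H R (Λ • r) • m = μ (𝓕.coextend (LinearMap.id (R := k)) m) := by
    rw [FrobeniusSystem.coextend_apply, map_sum, inclR_smul (Repr.arbitrary k Λ), Finset.sum_smul,
      hi, hl]
    refine Finset.sum_congr rfl fun i _ => ?_
    rw [hμ, hr, LinearMap.id_apply, hM, hM, mul_smul, mul_smul]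
  rw [this, ← hcz, Finsupp.sum, map_sum]
  exact Submodule.sum_mem _ fun i _ => Submodule.subset_span ⟨c i, hc i, _, (hμ _ _).symm⟩

end SmashProduct

/-! ### Finite-dimensional quotient implies stable finiteness. -/

namespace SmashProduct

variable {k : Type u} {H : Type v} {R : Type w} [Field k] [Ring H] [HopfAlgebra k H]
    [Ring R] [Algebra k R] [Module H R] [IsScalarTower k H R] [IsHopfModuleAlgebra k H R]

/-- If `R^H / ΛR` is finite-dimensional, then a finitely generated `R # H`-module is, over `H`, the
direct sum of a projective module and a finitely generated one. -/
theorem exists_isCompl_projective_finite [FiniteDimensional k H]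
    [IsNoetherian (hopfInvariants k H R) R] {Λ : H} (hΛ : IsLeftIntegral k Λ) (hΛ0 : Λ ≠ 0)
    [FiniteDimensional k (hopfInvariants k H R ⧸ LinearMap.range (integralMap k R hΛ))]
    {M : Type max v w} [AddCommGroup M] [Module (SmashProduct k H R) M] [Module H M]
    [Module.Finite (SmashProduct k H R) M] (hM : ∀ (h : H) (m : M), h • m = inclH k H R h • m) :
    ∃ P N : Submodule H M, IsCompl P N ∧ Module.Projective H P ∧ Module.Finite H N := by
  let : Module k M := Module.compHom M (algebraMap k (SmashProduct k H R))
  have : IsScalarTower k (SmashProduct k H R) M := .of_algebraMap_smul fun _ _ => rfl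
  have : IsScalarTower k H M := .of_algebraMap_smul fun c m => by
    rw [hM, AlgHom.commutes]
    rfl
  let : Module R M := Module.compHom M (inclR k H R).toRingHom
  have hR (r : R) (m : M) : r • m = inclR k H R r • m := rfl
  have : IsScalarTower k R M := .of_algebraMap_smul fun c m => by
    rw [hR, AlgHom.commutes]
    rfl
  have := isNoetherian_invariants (k := k) (H := H) hR
  have hcomm (c : hopfInvariants k H R) (h : H) (m : M) : h • c • m = c • h • m := by
    change h • (c : R) • m = (c : R) • h • m
    rw [hM, hM, hR, hR, ← mul_smul, ← mul_smul, inclH_mul_inclR c.2]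
  let S : Submodule (hopfInvariants k H R) M :=
    { (radicalSocle H M).toAddSubmonoid with
      smul_mem' := fun c m hm j hj => by rw [hcomm, hm j hj, smul_zero] }
  obtain ⟨n, s, hs⟩ := Submodule.fg_iff_exists_fin_generating_family.mp (IsNoetherian.noetherian S)
  obtain ⟨V, hV⟩ := Submodule.exists_isCompl (LinearMap.range (integralMap k R hΛ))
  have : FiniteDimensional k V := (Submodule.quotientEquivOfIsCompl _ V hV).finiteDimensional
  let ev (m : M) : hopfInvariants k H R →ₗ[k] M :=
    (LinearMap.toSpanSingleton (hopfInvariants k H R) M m).restrictScalars k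
  have hsS (i : Fin n) : s i ∈ radicalSocle H M := by
    have : s i ∈ S := hs ▸ Submodule.subset_span ⟨i, rfl⟩
    exact this
  obtain ⟨𝓕, -⟩ := hΛ.exists_frobeniusSystem hΛ0 (Coalgebra.Repr.arbitrary k Λ)
  -- `R^H = ΛR ⊕ V`: on the generators `s i` of the socle, `V` contributes a finite-dimensional
  -- space and `ΛR` lands in the socle span.
  refine 𝓕.exists_isCompl_projective_finite (⨆ i, V.map (ev (s i))) fun m hm => ?_
  have hmS : m ∈ Submodule.span (hopfInvariants k H R) (Set.range s) := hs ▸ hm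
  obtain ⟨c, rfl⟩ := (Submodule.mem_span_range_iff_exists_fun _).mp hmS
  refine Submodule.sum_mem _ fun i _ => ?_
  obtain ⟨_, ⟨r, rfl⟩, y, hy, hxy⟩ := Submodule.mem_sup.mp
    (hV.codisjoint.eq_top ▸ Submodule.mem_top : c i ∈ _)
  rw [← hxy, add_smul, add_comm]
  refine Submodule.add_mem_sup (Submodule.mem_iSup_of_mem i ⟨y, hy, rfl⟩) ?_
  exact inclR_integral_smul_mem_socleSpan hΛ hΛ0 hM r (hsS i)

end SmashProduct

/-! ### Stable isomorphisms in terms of modules, and the converse. -/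

section Stable

open CategoryTheory

variable {S : Type v} [Ring S]

/-- The projection to `N` followed by the inclusion differs from the identity by a map through `P`.
-/
theorem isStablyFG_of_isCompl {M : ModuleCat.{max v w} S} {P N : Submodule S M}
    (h : IsCompl P N) [Module.Projective S P] [Module.Finite S N] : IsStablyFG.{v, w} M := by
  refine ⟨ModuleCat.of S N, ‹_›, ⟨⟨(toStMod S).map (ModuleCat.ofHom (N.projectionOnto P h.symm)),
    (toStMod S).map (ModuleCat.ofHom N.subtype), ?_, ?_⟩⟩⟩
  · rw [← Functor.map_comp, ← CategoryTheory.Functor.map_id, toStMod_map_eq_iff]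
    refine ⟨ModuleCat.of S P, ModuleCat.ofHom (P.projectionOnto N h), ModuleCat.ofHom (-P.subtype),
      ‹_›, ?_⟩
    ext x
    have : (P.projectionOnto N h x : M) + N.projectionOnto P h.symm x = x :=
      Submodule.projection_add_projection_eq_self h x
    change -(P.projectionOnto N h x : M) = (N.projectionOnto P h.symm x : M) - x
    rw [neg_eq_iff_eq_neg, neg_sub]
    exact eq_sub_of_add_eq this
  · rw [← Functor.map_comp, ← CategoryTheory.Functor.map_id]
    congr 1
    ext x
    simp

/-- A stably finitely generated module maps to a finitely generated one in such a way that the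
composition with a suitable map back differs from the identity by a map through a projective. -/
theorem IsStablyFG.exists_linearMap {M : ModuleCat.{max v w} S} (h : IsStablyFG.{v, w} M) :
    ∃ (N P : ModuleCat.{max v w} S) (α : M →ₗ[S] N) (β : N →ₗ[S] M) (a : M →ₗ[S] P)
      (b : P →ₗ[S] M), Module.Finite S N ∧ Module.Projective S P ∧
      ∀ x, x = β (α x) + b (a x) := by
  obtain ⟨N, hN, ⟨e⟩⟩ := h
  obtain ⟨α, hα⟩ := (toStMod.{v, w} S).map_surjective e.hom
  obtain ⟨β, hβ⟩ := (toStMod.{v, w} S).map_surjective e.inv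
  have : (toStMod.{v, w} S).map (𝟙 M) = (toStMod S).map (α ≫ β) := by
    rw [Functor.map_comp, hα, hβ, e.hom_inv_id, CategoryTheory.Functor.map_id]
  obtain ⟨P, a, b, hP, hab⟩ := (toStMod_map_eq_iff _ _).mp this
  refine ⟨N, P, α.hom, β.hom, a.hom, b.hom, hN, hP, fun x => ?_⟩
  have := congrArg (fun f => f.hom x) hab
  simp only [ModuleCat.hom_comp, LinearMap.comp_apply, ModuleCat.hom_sub, LinearMap.sub_apply,
    ModuleCat.hom_id, LinearMap.id_apply] at this
  rw [this, add_sub_cancel]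

end Stable

open SmashProduct in
/-- If the `R # H`-module `R # Λ ≅ R` is stably finitely generated over `H`, then `R^H / ΛR` is
finite-dimensional. -/
theorem finiteDimensional_invariants_quotient {k : Type u} {H : Type v} {R : Type w} [Field k]
    [Ring H] [HopfAlgebra k H] [FiniteDimensional k H]
    [Ring R] [Algebra k R] [Module H R] [IsScalarTower k H R] [IsHopfModuleAlgebra k H R]
    {Λ : H} (hΛ : IsLeftIntegral k Λ) (hΛ0 : Λ ≠ 0)
    (h : IsStablyFG.{v, w} ((ModuleCat.restrictScalars (SmashProduct.inclH k H R).toRingHom).obj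
      (ModuleCat.of (SmashProduct k H R)
        (Submodule.span (SmashProduct k H R) {(mk 1 Λ : SmashProduct k H R)} : Submodule _ _)))) :
    FiniteDimensional k (hopfInvariants k H R ⧸ LinearMap.range (integralMap k R hΛ)) := by
  obtain ⟨N, P, α, β, a, b, hN, hP, hx⟩ := h.exists_linearMap
  let ι (r : R) : ((ModuleCat.restrictScalars (SmashProduct.inclH k H R).toRingHom).obj
      (ModuleCat.of (SmashProduct k H R)
        (Submodule.span (SmashProduct k H R) {(mk 1 Λ : SmashProduct k H R)} : Submodule _ _))) :=
    (⟨mk r Λ, (mem_span_mk_integral hΛ).mpr ⟨r, rfl⟩⟩ :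
      Submodule.span (SmashProduct k H R) {(mk 1 Λ : SmashProduct k H R)})
  have hι_smul (h : H) (r : R) : h • ι r = ι (h • r) :=
    Subtype.ext (inclH_mul_mk_integral hΛ h r)
  have hι_add (r s : R) : ι (r + s) = ι r + ι s := Subtype.ext (mk_add_left r s Λ)
  have hι_surj (x) : ∃ r, ι r = x := by
    obtain ⟨r, hr⟩ := (mem_span_mk_integral hΛ).mp x.2
    exact ⟨r, Subtype.ext hr⟩
  have hι_inj : Function.Injective ι := fun r s h => mk_left_injective hΛ0 (congrArg Subtype.val h)
  let : Module k N := Module.compHom N (algebraMap k H)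
  have : IsScalarTower k H N := .of_algebraMap_smul fun _ _ => rfl
  have : FiniteDimensional k N := Module.Finite.trans H N
  let φ : hopfInvariants k H R →ₗ[k] N :=
    { toFun := fun c => α (ι c)
      map_add' := fun c d => by rw [Subalgebra.coe_add, hι_add, map_add]
      map_smul' := fun t c => by
        have : ((t • c : hopfInvariants k H R) : R) = algebraMap k H t • (c : R) := by
          rw [algebraMap_smul]; rfl
        rw [this, ← hι_smul, map_smul, algebraMap_smul]
        rfl }
  -- The finite-dimensional target is `N / ΛN`; it remains to place the kernel inside `ΛR`.
  let ψ := (LinearMap.range (Algebra.lsmul k k N Λ)).mkQ ∘ₗ φ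
  have hker : LinearMap.ker ψ ≤ LinearMap.range (integralMap k R hΛ) := by
    intro c hc
    obtain ⟨n, hn⟩ := (Submodule.Quotient.mk_eq_zero _).mp hc
    replace hn : Λ • n = α (ι c) := hn
    have hinv (h : H) : h • ι c = algebraMap k H (Coalgebra.counit (R := k) h) • ι c := by
      rw [hι_smul, hι_smul, c.2 h, algebraMap_smul]
    obtain ⟨y, hy⟩ := hΛ.exists_smul_eq_of_projective hΛ0 (x := a (ι c)) fun h => by
      rw [← map_smul, hinv, map_smul]
    -- With `α(c) = Λn` and `a(c) = Λy`, the identity `c = β(α(c)) + b(a(c))` becomes `c = Λ(β(n) +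
    -- b(y))`.
    obtain ⟨r, hr⟩ := hι_surj (β n + b y)
    refine ⟨r, Subtype.ext (hι_inj ?_)⟩
    change ι (Λ • r) = ι c
    rw [← hι_smul, hr, smul_add, ← map_smul, ← map_smul, hn, hy, ← hx]
  have : FiniteDimensional k (hopfInvariants k H R ⧸ LinearMap.ker ψ) :=
    ψ.quotKerEquivRange.symm.finiteDimensional
  exact Module.Finite.of_surjective _ (Submodule.factor_surjective hker)

theorem proposition3p2
    (k : Type u) (H : Type v) (R : Type w) [Field k]
    [Ring H] [HopfAlgebra k H] [FiniteDimensional k H]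
    [Ring R] [Algebra k R] [Module H R] [IsScalarTower k H R] [IsHopfModuleAlgebra k H R]
    (Λ : H) (hΛ : IsLeftIntegral k Λ) (hΛ0 : Λ ≠ 0)
    [IsNoetherian (hopfInvariants k H R) R] :
    (∀ M : ModuleCat.{max v w} (SmashProduct k H R), Module.Finite (SmashProduct k H R) M →
      IsStablyFG.{v, w} ((ModuleCat.restrictScalars (SmashProduct.inclH k H R).toRingHom).obj M)) ↔
    FiniteDimensional k (hopfInvariants k H R ⧸ LinearMap.range (integralMap k R hΛ)) := by
  -- One cyclic test module suffices. The left ideal generated by `1 # Λ` replaces `R` because it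
  -- lies in `Type (max v w)`.
  refine ⟨fun h => finiteDimensional_invariants_quotient hΛ hΛ0 (h _ ?_), fun _ M hM => ?_⟩
  · exact Module.Finite.span_singleton _ _
  · let X := (ModuleCat.restrictScalars (SmashProduct.inclH k H R).toRingHom).obj M
    let : Module (SmashProduct k H R) X := inferInstanceAs (Module (SmashProduct k H R) M)
    have : Module.Finite (SmashProduct k H R) X := hM
    obtain ⟨P, N, hPN, hP, hN⟩ := SmashProduct.exists_isCompl_projective_finite (R := R)
      hΛ hΛ0 (M := X) fun _ _ => rfl
    exact isStablyFG_of_isCompl hPN
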